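/- For a finite-dimensional complex Lie algebra $\mathfrak{h}$ let $\mu(\mathfrak{h})$ denote the minimal dimension of a faithful (i.e. injective) linear representation of $\mathfrak{h}$, and for a representation $\phi$ of $\mathfrak{h}$ by complex $n\times n$ matrices let $C_\phi=\{A\in\mathfrak{gl}_n(\mathbb{C}) : [A,\phi(x)]=0 \text{ for all } x\in\mathfrak{h}\}$ be its centralizer, a Lie subalgebra of $\mathfrak{gl}_n(\mathbb{C})$. Let $\mathfrak{g}=\mathfrak{s}_1\oplus\cdots\oplus\mathfrak{s}_\ell$ be a finite-dimensional complex semisimple Lie algebra of length $\ell$, i.e. $\mathfrak{s}_1,\dots,\mathfrak{s}_\ell$ are simple ideals of $\mathfrak{g}$ and $\mathfrak{g}$ is their direct sum. Let $n\ge\mu(\mathfrak{g})$ be an integer and put $m=n-\mu(\mathfrak{g})$. For each $i$ let $\sigma_i\colon\mathfrak{s}_i\to\mathfrak{gl}_{\mu(\mathfrak{s}_i)}(\mathbb{C})$ be a faithful representation of minimal dimension, regarded as a representation of $\mathfrak{g}$ through the projection $\mathfrak{g}\to\mathfrak{s}_i$, let $\phi_0$ be the trivial one-dimensional representation of $\mathfrak{g}$,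 and let $$\sigma=m\,\phi_0\oplus\sigma_1\oplus\cdots\oplus\sigma_\ell$$ be the standard block representation. Then: 1. $\sigma$ has degree $m+\mu(\mathfrak{s}_1)+\cdots+\mu(\mathfrak{s}_\ell)=n$. 2. For every faithful representation $\phi\colon\mathfrak{g}\to\mathfrak{gl}_n(\mathbb{C})$ there is an injective Lie algebra homomorphism $C_\phi\hookrightarrow C_\sigma$. 3. $C_\sigma\cong\mathfrak{gl}_{n-\mu(\mathfrak{g})}(\mathbb{C})\oplus\mathbb{C}^\ell$ as Lie algebras, where $\mathbb{C}^\ell$ is abelian. -/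

import Mathlib

/- `Matrix ι ι ℂ` is regarded as the Lie algebra `𝔤𝔩_ι(ℂ)`, with the commutator `⁅A, B⁆ = A * B - B * A`. -/
attribute [local instance 100] LieRing.ofAssociativeRing

noncomputable section

/-- `μ(𝔤)`: the minimal dimension of a faithful linear representation of `𝔤`, i.e. the least `n`
such that there is an injective Lie algebra homomorphism `𝔤 → 𝔤𝔩_n(ℂ)`. -/
def minFaithfulDim (g : Type*) [LieRing g] [LieAlgebra ℂ g] : ℕ :=
  sInf {n : ℕ | ∃ φ : g →ₗ⁅ℂ⁆ Matrix (Fin n) (Fin n) ℂ, Function.Injective φ}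

/-- The centralizer `C_φ = {A | ⁅A, φ x⁆ = 0 for all x ∈ 𝔤}` of a matrix representation `φ`,
as a Lie subalgebra of the algebra of all matrices. -/
def repCentralizer {g ι : Type*} [LieRing g] [LieAlgebra ℂ g] [Fintype ι] [DecidableEq ι]
    (φ : g →ₗ⁅ℂ⁆ Matrix ι ι ℂ) : LieSubalgebra ℂ (Matrix ι ι ℂ) where
  carrier := {A | ∀ x : g, ⁅A, φ x⁆ = 0}
  add_mem' := by
    intro A B hA hB x
    rw [add_lie, hA x, hB x, add_zero]
  zero_mem' := by
    intro x
    rw [zero_lie]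
  smul_mem' := by
    intro c A hA x
    rw [smul_lie, hA x, smul_zero]
  lie_mem' := by
    intro A B hA hB x
    rw [lie_lie, hA x, hB x, lie_zero, lie_zero, sub_zero]

section Decomposition

variable {g : Type*} [LieRing g] [LieAlgebra ℂ g] {l : ℕ} {s : Fin l → LieIdeal ℂ g}

/-- Distinct ideals of an internal direct sum decomposition commute. -/
theorem lie_eq_zero_of_isInternal (hs : DirectSum.IsInternal s) :
    Pairwise fun i j => ∀ (x : s i) (y : s j), ⁅(s i).incl x, (s j).incl y⁆ = 0 := by
  intro i j hij x y
  have hi : ⁅(x : g), (y : g)⁆ ∈ s i := lie_mem_left ℂ g (s i) x y x.2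
  have hj : ⁅(x : g), (y : g)⁆ ∈ s j := lie_mem_right ℂ g (s j) x y y.2
  have h := hs.1 (a₁ := DirectSum.of (fun i => s i) i ⟨_, hi⟩)
    (a₂ := DirectSum.of (fun i => s i) j ⟨_, hj⟩) (by
      rw [DirectSum.coeAddMonoidHom_of, DirectSum.coeAddMonoidHom_of])
  have h2 := congrArg (fun z => z i) h
  simp only [DirectSum.of_eq_same] at h2
  rw [DirectSum.of_eq_of_ne _ _ _ hij] at h2
  exact congrArg Subtype.val h2

/-- The Lie algebra isomorphism `⨁ i, 𝔰_i ≃ 𝔤`, `(x_i) ↦ ∑ x_i`, attached to an internal direct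
sum decomposition of `𝔤` into ideals. -/
def sumEquiv (hs : DirectSum.IsInternal s) : (DirectSum (Fin l) fun i => s i) ≃ₗ⁅ℂ⁆ g :=
  LieEquiv.ofBijective
    (DirectSum.toLieAlgebra g (fun i => (s i).incl) (lie_eq_zero_of_isInternal hs)) (by
      have h : ⇑(DirectSum.toLieAlgebra g (fun i => (s i).incl) (lie_eq_zero_of_isInternal hs)) =
          ⇑(DirectSum.coeAddMonoidHom s) := by
        funext z
        induction z using DirectSum.induction_on with
        | zero => simp
        | of i x =>
          rw [DirectSum.coeAddMonoidHom_of]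
          exact DirectSum.toModule_lof (M := fun i => s i)
            (φ := fun i => ((s i).incl : s i →ₗ[ℂ] g)) ℂ i x
        | add a b ha hb => rw [map_add, map_add, ha, hb]
      rw [h]
      exact hs)

/-- The projection `𝔤 → 𝔰_i` of `𝔤 = ⨁ i, 𝔰_i` onto its `i`-th summand. -/
def idealProj (hs : DirectSum.IsInternal s) (i : Fin l) : g →ₗ⁅ℂ⁆ s i :=
  (DirectSum.lieAlgebraComponent ℂ (Fin l) (fun i => s i) i).comp (sumEquiv hs).symm.toLieHom

/-- The representation `m φ₀ ⊕ σ_1 ⊕ ⋯ ⊕ σ_ℓ` of `𝔤 = 𝔰_1 ⊕ ⋯ ⊕ 𝔰_ℓ`, where `φ₀` is the trivial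
one-dimensional representation and `σ_i` is a representation of `𝔰_i` of degree `d i`, viewed as a
representation of `𝔤` through the projection `𝔤 → 𝔰_i`:
`x = ∑ x_i` acts by the block diagonal matrix `diag(0, …, 0, σ_1(x_1), …, σ_ℓ(x_ℓ))`. -/
def blockRep (hs : DirectSum.IsInternal s) (m : ℕ) (d : Fin l → ℕ)
    (σ : ∀ i, s i →ₗ⁅ℂ⁆ Matrix (Fin (d i)) (Fin (d i)) ℂ) :
    g →ₗ⁅ℂ⁆ Matrix (Fin m ⊕ (Σ i, Fin (d i))) (Fin m ⊕ (Σ i, Fin (d i))) ℂ where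
  toFun x := Matrix.fromBlocks 0 0 0 (Matrix.blockDiagonal' fun i => σ i (idealProj hs i x))
  map_add' x y := by
    simp only [map_add, Matrix.fromBlocks_add, add_zero]
    rw [← Matrix.blockDiagonal'_add]
    rfl
  map_smul' c x := by
    simp only [map_smul, Matrix.fromBlocks_smul, smul_zero, RingHom.id_apply]
    rw [← Matrix.blockDiagonal'_smul]
    rfl
  map_lie' := by
    intro x y
    simp only [LieHom.map_lie, Ring.lie_def, Matrix.fromBlocks_multiply, Matrix.mul_zero,
      Matrix.zero_mul, add_zero, zero_add, sub_eq_add_neg, Matrix.fromBlocks_neg,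
      Matrix.fromBlocks_add, neg_zero]
    rw [← Matrix.blockDiagonal'_mul, ← Matrix.blockDiagonal'_mul, ← Matrix.blockDiagonal'_neg,
      ← Matrix.blockDiagonal'_add]
    rfl

end Decomposition

end

/-! ### Perfect ideals and trace forms of semisimple Lie algebras. -/

section Perfect

variable {K L : Type*} [Field K] [LieRing L] [LieAlgebra K L]

/-! By Weyl's theorem, Schur's lemma and Wedderburn, `φ` splits into irreducibles `τ j` of degree `d
j` and multiplicity `m j`, with `∑ m j * d j = n`, and its centralizer is `∏ 𝔤𝔩_{m j}`. Everything
then rests on degree counts and on `m + d ≤ m * d` for `m, d ≥ 2`.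

Additivity of `μ`: let simple algebras act faithfully and commute pairwise. Decompose under one of
them; the others act on its multiplicity spaces, where induction bounds their minimal degrees by `m
j`. Some `τ j` is faithful, and there the numerical inequality pays for both contributions
(`sum_minFaithfulDim_le_of_commute`).

Embedding: choose for each `𝔰_i` a constituent on which it is nontrivial, and let `J` be the set of
those chosen. By additivity `∑_J d ≥ ∑ μ(𝔰_i)`. The factors from `J` of multiplicity one are at most
`ℓ` copies of `ℂ`; the numerical inequality fits all the others into `𝔤𝔩_{n-μ(𝔤)}`.

Centralizer of `σ`: by minimality each `σ_i` is irreducible, and its Casimir operator is a nonzero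
scalar, so there are no intertwiners between different blocks or with the trivial part. Only `𝔤𝔩_m`
and one scalar per block remain. -/

theorem LieSubmodule.lie_lie_le {M : Type*} [AddCommGroup M] [Module K M] [LieRingModule L M]
    [LieModule K L M] (I J : LieIdeal K L) (N : LieSubmodule K L M) :
    ⁅⁅I, J⁆, N⁆ ≤ ⁅I, ⁅J, N⁆⁆ ⊔ ⁅J, ⁅I, N⁆⁆ := by
  rw [LieSubmodule.lie_le_iff]
  intro x hx m hm
  rw [← LieSubmodule.mem_toSubmodule, LieSubmodule.lieIdeal_oper_eq_linear_span'] at hx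
  induction hx using Submodule.span_induction with
  | mem y hy =>
    obtain ⟨a, ha, b, hb, rfl⟩ := hy
    rw [lie_lie]
    exact sub_mem
      ((le_sup_left : _ ≤ ⁅I, ⁅J, N⁆⁆ ⊔ ⁅J, ⁅I, N⁆⁆)
        (LieSubmodule.lie_mem_lie ha (LieSubmodule.lie_mem_lie hb hm)))
      ((le_sup_right : _ ≤ ⁅I, ⁅J, N⁆⁆ ⊔ ⁅J, ⁅I, N⁆⁆)
        (LieSubmodule.lie_mem_lie hb (LieSubmodule.lie_mem_lie ha hm)))
  | zero => rw [zero_lie]; exact zero_mem _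
  | add a b _ _ ha hb => rw [add_lie]; exact add_mem ha hb
  | smul c a _ ha => rw [smul_lie]; exact SMulMemClass.smul_mem c ha

/-- A nilpotent module over a perfect Lie algebra is trivial. -/
theorem LieModule.lie_eq_zero_of_isNilpotent_of_perfect {V : Type*} [AddCommGroup V] [Module K V]
    [LieRingModule L V] [LieModule K L V] [LieModule.IsNilpotent L V]
    (hL : ⁅(⊤ : LieIdeal K L), (⊤ : LieIdeal K L)⁆ = ⊤) (x : L) (v : V) : ⁅x, v⁆ = 0 := by
  -- The lower central series stabilises at index 1: perfectness and the Jacobi identity give `LV =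
  -- [L,L]V ⊆ L(LV)`.
  have key : ∀ k, lowerCentralSeries K L V 1 ≤ lowerCentralSeries K L V k := by
    intro k
    induction k with
    | zero => simp
    | succ k ih =>
      calc lowerCentralSeries K L V 1 = ⁅⁅(⊤ : LieIdeal K L), (⊤ : LieIdeal K L)⁆,
              (⊤ : LieSubmodule K L V)⁆ := by
            rw [hL, lowerCentralSeries_succ, lowerCentralSeries_zero]
        _ ≤ ⁅(⊤ : LieIdeal K L), lowerCentralSeries K L V 1⁆ := by
            rw [lowerCentralSeries_succ, lowerCentralSeries_zero]
            exact (LieSubmodule.lie_lie_le _ _ _).trans_eq (sup_idem _)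
        _ ≤ lowerCentralSeries K L V (k + 1) := by
            rw [lowerCentralSeries_succ K L V k]
            exact LieSubmodule.mono_lie_right _ ih
  obtain ⟨k, hk⟩ := (isNilpotent_iff K L V).mp inferInstance
  have h : ⁅x, v⁆ ∈ lowerCentralSeries K L V 1 := by
    rw [lowerCentralSeries_succ, lowerCentralSeries_zero]
    exact LieSubmodule.lie_mem_lie (LieSubmodule.mem_top x) (LieSubmodule.mem_top v)
  have := key k h
  rwa [hk] at this

variable [CharZero K] [FiniteDimensional K L] [LieAlgebra.HasTrivialRadical K L]

/-- Every ideal of a semisimple Lie algebra is perfect. -/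
theorem LieIdeal.lie_self_eq (I : LieIdeal K L) : ⁅I, I⁆ = I := by
  refine le_antisymm (LieSubmodule.lie_le_left I I) ?_
  -- The bracket of this ideal with itself lies in both `⁅I, I⁆` and its complement, so the ideal is
  -- abelian.
  have h : I ⊓ ⁅I, I⁆ᶜ = ⊥ := by
    have h1 : ⁅I ⊓ ⁅I, I⁆ᶜ, I ⊓ ⁅I, I⁆ᶜ⁆ = (⊥ : LieIdeal K L) := by
      rw [eq_bot_iff, ← inf_compl_self ⁅I, I⁆]
      exact le_inf (LieSubmodule.mono_lie inf_le_left inf_le_left)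
        ((LieSubmodule.lie_le_left _ _).trans inf_le_right)
    have h2 := (LieSubmodule.lie_abelian_iff_lie_self_eq_bot _).mpr h1
    exact (LieAlgebra.hasTrivialRadical_iff_no_abelian_ideals K L).mp inferInstance _ h2
  rw [← disjoint_iff, disjoint_compl_right_iff] at h
  exact h

variable {V : Type*} [AddCommGroup V] [Module K V] [FiniteDimensional K V]
  [LieRingModule L V] [LieModule K L V]

/-- For a representation of a semisimple Lie algebra, the radical of the trace form acts
trivially. -/
theorem LieModule.lie_eq_zero_of_traceForm_eq_zero
    {x : L} (hx : ∀ y, traceForm K L V x y = 0) (v : V) : ⁅x, v⁆ = 0 := by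
  -- The radical of the trace form is an ideal by invariance, and its own trace form on `V`
  -- vanishes.
  let I : LieIdeal K L :=
    { LinearMap.ker (traceForm K L V) with
      lie_mem := by
        intro x y hy
        have hy' : traceForm K L V y = 0 := hy
        change traceForm K L V ⁅x, y⁆ = 0
        ext z
        rw [← lie_skew, map_neg, LinearMap.neg_apply, traceForm_apply_lie_apply, hy']
        simp }
  have hxI : x ∈ I := LinearMap.ext hx
  have h0 : traceForm K I V = 0 := by
    ext y z
    have : traceForm K L V y = 0 := y.2
    exact congrArg (fun f => f (z : L)) this
  have hI : ⁅(⊤ : LieIdeal K I), (⊤ : LieIdeal K I)⁆ = ⊤ := by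
    have := LieIdeal.derivedSeries_eq_derivedSeriesOfIdeal_comap (R := K) (I := I) 1
    rwa [LieAlgebra.derivedSeries_def, LieAlgebra.derivedSeriesOfIdeal_succ,
      LieAlgebra.derivedSeriesOfIdeal_zero, LieAlgebra.derivedSeriesOfIdeal_succ,
      LieAlgebra.derivedSeriesOfIdeal_zero, I.lie_self_eq, LieIdeal.comap_incl_self] at this
  -- Cartan's criterion makes the derived algebra of `I` act nilpotently; since `I` is perfect, that
  -- is all of `I`.
  have hn := isNilpotent_derivedSeries_of_traceForm_eq_zero h0
  have hn' : IsNilpotent I V := by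
    rw [isNilpotent_iff_forall' (R := K)] at hn ⊢
    intro y
    refine hn ⟨y, ?_⟩
    rw [LieAlgebra.derivedSeries_def, LieAlgebra.derivedSeriesOfIdeal_succ,
      LieAlgebra.derivedSeriesOfIdeal_zero, hI]
    exact LieSubmodule.mem_top y
  exact lie_eq_zero_of_isNilpotent_of_perfect hI ⟨x, hxI⟩ v

/-! ### The Casimir operator and Weyl's theorem. -/

open Module

variable (K L V) in
/-- The Casimir element of a representation. -/
theorem LieModule.exists_casimir :
    ∃ Ω : End K V, (∀ x, Ω * toEnd K L V x = toEnd K L V x * Ω) ∧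
      (∀ W : Submodule K V, (∀ (x : L) (v : V), ⁅x, v⁆ ∈ W) → ∀ v, Ω v ∈ W) ∧
      (∀ v : V, (∀ x : L, ⁅x, v⁆ = 0) → Ω v = 0) ∧
      LinearMap.trace K V Ω = finrank K (LinearMap.range (toEnd K L V : L →ₗ[K] End K V)) := by
  -- Working in the image of `L` makes the trace form nondegenerate even when the representation is
  -- not faithful.
  set p := LinearMap.range (toEnd K L V : L →ₗ[K] End K V) with hp
  let B : LinearMap.BilinForm K p :=
    ((LinearMap.mul K (End K V)).compr₂ (LinearMap.trace K V)).domRestrict₁₂ p p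
  have hBapp : ∀ a b : p, B a b = LinearMap.trace K V (a.1 * b.1) := fun a b => rfl
  have hsymm : ∀ a b, B a b = B b a := fun a b => by
    rw [hBapp, hBapp, LinearMap.trace_mul_comm]
  have hBs : B.IsSymm := ⟨hsymm⟩
  have hB : B.Nondegenerate := by
    rw [LinearMap.BilinForm.Nondegenerate, LinearMap.IsRefl.nondegenerate_iff_separatingLeft hBs.isRefl]
    rintro ⟨_, ⟨x, rfl⟩⟩ h
    ext v
    exact lie_eq_zero_of_traceForm_eq_zero (fun y => h ⟨_, ⟨y, rfl⟩⟩) v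
  let e := finBasis K p
  let e' := B.dualBasis hB e
  have hlie : ∀ (x : L) (a : p), ⁅toEnd K L V x, a.1⁆ ∈ p := by
    rintro x ⟨_, ⟨y, rfl⟩⟩
    exact ⟨⁅x, y⁆, (toEnd K L V).map_lie x y⟩
  have h1 : ∀ a : p, a.1 = ∑ j, B a (e j) • (e' j).1 := fun a => by
    conv_lhs => rw [← e'.sum_repr a]
    simp [e']
  have h2 : ∀ a : p, a.1 = ∑ j, B (e' j) a • (e j).1 := fun a => by
    conv_lhs => rw [← e.sum_repr a]
    have : ∀ j, e.repr a j = B (e' j) a := fun j => by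
      have := LinearMap.BilinForm.dualBasis_repr_apply hB e' a j
      rw [LinearMap.BilinForm.dualBasis_dualBasis hB hBs] at this
      rw [this, hsymm]
    simp [this]
  have hinv : ∀ (x : L) (a b : p), B ⟨_, hlie x a⟩ b + B a ⟨_, hlie x b⟩ = 0 := fun x a b => by
    rw [hBapp, hBapp, ← map_add]
    simp only [Ring.lie_def, sub_mul, mul_sub, map_add, map_sub]
    rw [mul_assoc (toEnd K L V x) a.1 b.1, LinearMap.trace_mul_comm K (toEnd K L V x),
      mul_assoc a.1 b.1, mul_assoc a.1 (toEnd K L V x)]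
    ring
  -- In the commutator with `x`, the two sums of coefficients cancel by `hinv`.
  refine ⟨∑ i, (e' i).1 * (e i).1, ?_, ?_, ?_, ?_⟩
  · intro x
    rw [eq_comm, ← sub_eq_zero, ← Ring.lie_def, lie_sum]
    have : ∀ i, ⁅toEnd K L V x, (e' i).1 * (e i).1⁆ =
        ∑ j, B ⟨_, hlie x (e' i)⟩ (e j) • ((e' j).1 * (e i).1) +
        ∑ j, B (e' j) ⟨_, hlie x (e i)⟩ • ((e' i).1 * (e j).1) := fun i => by
      have e1 := h1 ⟨_, hlie x (e' i)⟩
      have e2 := h2 ⟨_, hlie x (e i)⟩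
      simp only [← smul_mul_assoc, ← Finset.sum_mul]
      simp only [smul_mul_assoc, ← mul_smul_comm, ← Finset.mul_sum]
      rw [← e1, ← e2]
      simp only [Ring.lie_def]
      noncomm_ring
    simp only [this, Finset.sum_add_distrib]
    rw [Finset.sum_comm (f := fun i j => B (e' j) ⟨_, hlie x (e i)⟩ • ((e' i).1 * (e j).1))]
    simp only [← Finset.sum_add_distrib, ← add_smul, hinv, zero_smul, Finset.sum_const_zero]
  · intro W hW v
    rw [LinearMap.sum_apply]
    refine Submodule.sum_mem _ fun i _ => ?_
    obtain ⟨y, hy⟩ := (e' i).2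
    rw [← hy]
    exact hW y _
  · intro v hv
    rw [LinearMap.sum_apply]
    refine Finset.sum_eq_zero fun i _ => ?_
    obtain ⟨y, hy⟩ := (e i).2
    have : (e i).1 v = 0 := by rw [← hy]; exact hv y
    rw [Module.End.mul_apply, this, map_zero]
  · rw [map_sum]
    have : ∀ i, LinearMap.trace K V ((e' i).1 * (e i).1) = 1 := fun i => by
      rw [← hBapp, LinearMap.BilinForm.apply_dualBasis_left, if_pos rfl]
    simp [this]

/-- Vanishing of the first cohomology, in terms of submodules with trivial quotient. -/
theorem LieModule.exists_invariant_add (n : ℕ) : ∀ {V : Type*} [AddCommGroup V] [Module K V]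
    [FiniteDimensional K V] [LieRingModule L V] [LieModule K L V], finrank K V = n →
    ∀ (W : Submodule K V), (∀ (x : L) (v : V), ⁅x, v⁆ ∈ W) →
    ∀ v, ∃ w ∈ W, ∃ u, v = w + u ∧ ∀ x : L, ⁅x, u⁆ = 0 := by
  induction n using Nat.strong_induction_on with
  | _ n ih =>
  intro V _ _ _ _ _ hn W hW v
  obtain ⟨Ω, hcomm, hΩ, -, htr⟩ := exists_casimir K L V
  -- Fitting decomposition of `Ω`. The exponent `N + 1` is positive, so the range part lies in `W`;
  -- induction handles the kernel part when it is proper.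
  obtain ⟨N, hN⟩ := Filter.eventually_atTop.mp Ω.eventually_isCompl_ker_pow_range_pow
  replace hN := hN (N + 1) N.le_succ
  have hker : ∀ (x : L) (u : V), (Ω ^ (N + 1)) u = 0 → (Ω ^ (N + 1)) ⁅x, u⁆ = 0 := by
    intro x u hu
    have h : Commute (Ω ^ (N + 1)) (toEnd K L V x) := (show Commute _ _ from hcomm x).pow_left _
    have := congrArg (fun f => f u) h.eq
    simp only [Module.End.mul_apply, hu, map_zero] at this
    exact this
  let V₀ : LieSubmodule K L V :=
    { LinearMap.ker (Ω ^ (N + 1)) with lie_mem := fun {x u} hu => hker x u hu }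
  have hrange : ∀ u, (Ω ^ (N + 1)) u ∈ W := fun u => by
    rw [pow_succ']; exact hΩ W hW _
  by_cases hlt : finrank K V₀ < n
  · obtain ⟨a, ha, b, hb, rfl⟩ := Submodule.mem_sup.mp
      (hN.sup_eq_top ▸ Submodule.mem_top : v ∈ _)
    obtain ⟨w, hw, u, hu, hu'⟩ := ih _ hlt (V := V₀) rfl (W.comap V₀.toSubmodule.subtype)
      (fun x v => hW x v) ⟨a, ha⟩
    obtain ⟨c, rfl⟩ := hb
    refine ⟨w + (Ω ^ (N + 1)) c, W.add_mem hw (hrange c), u, ?_, fun x => ?_⟩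
    · have := congrArg Subtype.val hu
      simp only at this
      rw [this, LieSubmodule.coe_add]; abel
    · exact congrArg Subtype.val (hu' x)
  -- Otherwise `Ω` is nilpotent, so its trace, the dimension of the image of `L`, is zero and `L`
  -- acts trivially.
  · have htop : V₀.toSubmodule = ⊤ :=
      Submodule.eq_top_of_finrank_eq (le_antisymm (Submodule.finrank_le _) (hn ▸ not_lt.mp hlt))
    have hnil : _root_.IsNilpotent Ω := ⟨N + 1, by
      ext u
      have : u ∈ V₀.toSubmodule := htop ▸ Submodule.mem_top
      exact this⟩
    have h0 := (LinearMap.isNilpotent_trace_of_isNilpotent hnil).eq_zero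
    rw [htr, Nat.cast_eq_zero, Submodule.finrank_eq_zero, LinearMap.range_eq_bot] at h0
    exact ⟨0, W.zero_mem, v, (zero_add v).symm, fun x => congrArg (fun f => f x v) h0⟩

/-- **Weyl's theorem** on complete reducibility. -/
theorem LieModule.exists_isCompl_of_hasTrivialRadical (W : LieSubmodule K L V) :
    ∃ W' : LieSubmodule K L V, IsCompl W.toSubmodule W'.toSubmodule := by
  -- `L` maps `P` (scalar on `W`) into `Q` (zero on `W`). Correcting a linear projection by an
  -- element of `Q` yields an invariant projection, whose kernel is the complement.
  let P : LieSubmodule K L (V →ₗ[K] W) :=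
    { carrier := {f | ∃ c : K, ∀ w : W, f w = c • w}
      add_mem' := by
        rintro f g ⟨c, hc⟩ ⟨d, hd⟩
        exact ⟨c + d, fun w => by rw [LinearMap.add_apply, hc, hd, add_smul]⟩
      zero_mem' := ⟨0, fun w => by simp⟩
      smul_mem' := by
        rintro a f ⟨c, hc⟩
        exact ⟨a * c, fun w => by rw [LinearMap.smul_apply, hc, smul_smul]⟩
      lie_mem := by
        rintro x f ⟨c, hc⟩
        refine ⟨0, fun w => ?_⟩
        have := hc ⁅x, w⁆
        rw [LieSubmodule.coe_bracket] at this
        rw [LieHom.lie_apply, hc, this, lie_smul, sub_self, zero_smul] }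
  have hP : ∀ f : P, ∃ c : K, ∀ w : W, f.1 w = c • w := fun f => f.2
  let Q : Submodule K P :=
    { carrier := {f | ∀ w : W, f.1 w = 0}
      add_mem' := fun {f g} hf hg w => by
        rw [LieSubmodule.coe_add, LinearMap.add_apply, hf, hg, add_zero]
      zero_mem' := fun w => rfl
      smul_mem' := fun a f hf w => by
        rw [LieSubmodule.coe_smul, LinearMap.smul_apply, hf, smul_zero] }
  obtain ⟨π, hπ⟩ := W.toSubmodule.subtype.exists_leftInverse_of_injective
    (LinearMap.ker_eq_bot.mpr W.toSubmodule.injective_subtype)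
  have hπ' : ∀ w : W, π w = w := fun w => congrArg (fun f => f w) hπ
  obtain ⟨q, hq, f, hf, hinv⟩ := exists_invariant_add (L := L) _ rfl Q (by
    intro x f w
    obtain ⟨c, hc⟩ := hP f
    have := hc ⁅x, w⁆
    rw [LieSubmodule.coe_bracket] at this
    rw [LieSubmodule.coe_bracket, LieHom.lie_apply, hc, this, lie_smul, sub_self])
    ⟨π, 1, fun w => by rw [hπ', one_smul]⟩
  have hfW : ∀ w : W, f.1 w = w := fun w => by
    have := congrArg (fun g : P => g.1 w) hf
    simp only [LieSubmodule.coe_add, LinearMap.add_apply, hπ', hq w, zero_add] at this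
    exact this.symm
  have heq : ∀ (x : L) (v : V), f.1 ⁅x, v⁆ = ⁅x, f.1 v⁆ := fun x v => by
    have := congrArg (fun g : P => g.1 v) (hinv x)
    simp only [LieSubmodule.coe_bracket, LieHom.lie_apply] at this
    exact (sub_eq_zero.mp this).symm
  refine ⟨{ LinearMap.ker f.1 with
    lie_mem := fun {x v} (hv : f.1 v = 0) => by
      change f.1 ⁅x, v⁆ = 0
      rw [heq, hv, lie_zero] }, LinearMap.isCompl_of_proj hfW⟩

end Perfect

/-! ### Wedderburn decomposition of semisimple modules. -/

section Wedderburn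

open Module

/-- A semisimple module is a product of powers of simple modules, and its endomorphism algebra is the
corresponding product of matrix algebras. -/
theorem IsSemisimpleModule.exists_linearEquiv_pi_and_end_algEquiv (K A M : Type*) [CommSemiring K]
    [Ring A] [Algebra K A] [AddCommGroup M] [Module K M] [Module A M] [IsScalarTower K A M]
    [IsSemisimpleModule A M] [Module.Finite A M] :
    ∃ (n : ℕ) (S : Fin n → Submodule A M) (m : Fin n → ℕ),
      (∀ i, IsSimpleModule A (S i)) ∧ (∀ i, NeZero (m i)) ∧
      Nonempty (M ≃ₗ[A] Π i, Fin (m i) → S i) ∧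
      Nonempty (End A M ≃ₐ[K] Π i, Matrix (Fin (m i)) (Fin (m i)) (End A (S i))) := by
  classical
  choose d pos S _ simple e using fun c : isotypicComponents A M ↦
    (IsIsotypic.isotypicComponents c.2).submodule_linearEquiv_fun
  have := Fintype.ofFinite (isotypicComponents A M)
  refine ⟨_, _, _, fun _ ↦ simple _, fun _ ↦ pos _, ⟨?_⟩,
    ⟨.trans (endAlgEquiv K A M) <| .trans
    (.piCongrRight fun c ↦ ((e c).some.conjAlgEquiv K).trans (endVecAlgEquivMatrixEnd ..)) <|
    (.piCongrLeft' K _ (Finite.equivFin _))⟩⟩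
  have ind := (sSupIndep_iff _).mp <| sSupIndep_isotypicComponents A M
  have top := (sSup_eq_iSup' _).symm.trans <| sSup_isotypicComponents A M
  exact (ind.linearEquiv top).symm.trans <| (DFinsupp.linearEquivFunOnFintype (R := A)).trans <|
    (LinearEquiv.piCongrRight fun c => (e c).some).trans
      (LinearEquiv.piCongrLeft' A _ (Finite.equivFin _))

/-- The decomposition of a semisimple module over an algebra into simple modules, in matrix form,
together with its endomorphism algebra. -/
theorem IsSemisimpleModule.exists_matrix_algHom (K A V : Type*) [Field K] [IsAlgClosed K]
    [Ring A] [Algebra K A] [AddCommGroup V] [Module K V] [FiniteDimensional K V] [Module A V]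
    [IsScalarTower K A V] [IsSemisimpleModule A V] :
    ∃ (k : ℕ) (m d : Fin k → ℕ) (τ : ∀ i, A →ₐ[K] Matrix (Fin (d i)) (Fin (d i)) K),
      (∀ i, m i ≠ 0) ∧ (∀ i, d i ≠ 0) ∧ ∑ i, m i * d i = finrank K V ∧
      (∀ a, (∀ i, τ i a = 0) → ∀ v : V, a • v = 0) ∧
      Nonempty (End A V ≃ₐ[K] Π i, Matrix (Fin (m i)) (Fin (m i)) K) := by
  have : Module.Finite A V := Module.Finite.of_restrictScalars_finite K A _
  obtain ⟨k, S, m, hS, hm, ⟨e⟩, ⟨E⟩⟩ :=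
    IsSemisimpleModule.exists_linearEquiv_pi_and_end_algEquiv K A V
  have hfin : ∀ i, FiniteDimensional K (S i) := fun i =>
    inferInstanceAs (FiniteDimensional K ((S i).restrictScalars K))
  let b := fun i => finBasis K (S i)
  refine ⟨k, m, fun i => finrank K (S i), fun i =>
    (LinearMap.toMatrixAlgEquiv (b i) : _ →ₐ[K] _).comp
      (Algebra.lsmul K K (S i) : A →ₐ[K] _),
    fun i => (hm i).out, fun i => ?_, ?_, ?_, ⟨?_⟩⟩
  · have := IsSimpleModule.nontrivial A (S i)
    exact (Module.finrank_pos).ne'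
  · have := (e.restrictScalars K).finrank_eq
    simp only [finrank_pi_fintype, Finset.sum_const, Finset.card_univ,
      Fintype.card_fin, smul_eq_mul] at this
    exact this.symm
  · intro a ha v
    apply e.injective
    rw [map_smul, map_zero]
    funext i j
    have h := (LinearMap.toMatrixAlgEquiv (b i)).injective ((ha i).trans (map_zero _).symm)
    exact congrArg (fun f => f (e v i j)) h
  -- Schur's lemma: `End A (S i)` is `K`, as `K` is algebraically closed.
  · exact E.trans <| AlgEquiv.piCongrRight fun i =>
      (AlgEquiv.ofBijective (Algebra.ofId K (End A (S i)))
        (IsSimpleModule.algebraMap_end_bijective_of_isAlgClosed K)).symm.mapMatrix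

end Wedderburn

/-! ### Centralizers of representations. -/

section Centralizer

open Module

variable {K L : Type*} [Field K] [CharZero K] [LieRing L] [LieAlgebra K L] [FiniteDimensional K L]
  [LieAlgebra.HasTrivialRadical K L] {V : Type*} [AddCommGroup V] [Module K V]
  [FiniteDimensional K V]

/-- The associative algebra generated by a representation of a semisimple Lie algebra acts
semisimply. -/
theorem LieHom.isSemisimpleModule_adjoin_range (ρ : L →ₗ⁅K⁆ End K V) :
    IsSemisimpleModule (Algebra.adjoin K (Set.range ρ)) V := by
  let _ : LieRingModule L V := LieRingModule.compLieHom V ρ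
  have _ : LieModule K L V := LieModule.compLieHom V ρ
  have hρ : ∀ (x : L) (v : V), ⁅x, v⁆ = ρ x v := fun x v => rfl
  set A := Algebra.adjoin K (Set.range ρ)
  refine { exists_isCompl := fun N => ?_ }
  -- The generated associative algebra and `L` have the same stable subspaces, so Weyl's complement
  -- can be carried over.
  let N' : LieSubmodule K L V :=
    { N.restrictScalars K with
      lie_mem := fun {x v} hv =>
        N.smul_mem (⟨ρ x, Algebra.subset_adjoin ⟨x, rfl⟩⟩ : A) hv }
  obtain ⟨W, hW⟩ := LieModule.exists_isCompl_of_hasTrivialRadical N'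
  let W' : Submodule A V :=
    { W.toSubmodule with
      smul_mem' := by
        rintro ⟨a, ha⟩ v hv
        change a v ∈ W.toSubmodule
        replace hv : v ∈ W.toSubmodule := hv
        induction ha using Algebra.adjoin_induction generalizing v with
        | mem y hy => obtain ⟨x, rfl⟩ := hy; exact W.lie_mem hv
        | algebraMap r => exact W.toSubmodule.smul_mem r hv
        | add a b _ _ ha hb => exact W.toSubmodule.add_mem (ha hv) (hb hv)
        | mul a b _ _ ha hb => exact ha (hb hv) }
  refine ⟨W', ?_, ?_⟩
  · rw [Submodule.disjoint_def]
    exact fun v => Submodule.disjoint_def.mp hW.disjoint v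
  · rw [codisjoint_iff, Submodule.eq_top_iff']
    intro v
    obtain ⟨a, ha, b, hb, rfl⟩ := Submodule.mem_sup.mp
      (hW.sup_eq_top ▸ Submodule.mem_top : v ∈ N'.toSubmodule ⊔ W.toSubmodule)
    exact Submodule.add_mem_sup ha hb

/-- The decomposition of a matrix representation `φ` of a semisimple Lie algebra into
irreducible representations `τ i` with multiplicities `m i`, together with the resulting
description of its centralizer. -/
theorem LieHom.exists_centralizer_algEquiv_pi_matrix [IsAlgClosed K] {n : ℕ}
    (φ : L →ₗ⁅K⁆ Matrix (Fin n) (Fin n) K) :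
    ∃ (k : ℕ) (m d : Fin k → ℕ) (τ : ∀ i, L →ₗ⁅K⁆ Matrix (Fin (d i)) (Fin (d i)) K),
      (∀ i, m i ≠ 0) ∧ (∀ i, d i ≠ 0) ∧ ∑ i, m i * d i = n ∧
      (∀ x, (∀ i, τ i x = 0) → φ x = 0) ∧
      Nonempty (Subalgebra.centralizer K (Set.range φ) ≃ₐ[K]
        Π i, Matrix (Fin (m i)) (Fin (m i)) K) := by
  let T : Matrix (Fin n) (Fin n) K ≃ₐ[K] End K (Fin n → K) := Matrix.toLinAlgEquiv'
  let ρ : L →ₗ⁅K⁆ End K (Fin n → K) := (T : Matrix (Fin n) (Fin n) K →ₐ[K] _).toLieHom.comp φ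
  have hρ : ∀ x, ρ x = T (φ x) := fun x => rfl
  have := ρ.isSemisimpleModule_adjoin_range
  set A := Algebra.adjoin K (Set.range ρ)
  obtain ⟨k, m, d, τ, hm, hd, hsum, hker, ⟨E⟩⟩ :=
    IsSemisimpleModule.exists_matrix_algHom K A (Fin n → K)
  let ρA : L →ₗ⁅K⁆ A :=
    { toFun := fun x => ⟨ρ x, Algebra.subset_adjoin ⟨x, rfl⟩⟩
      map_add' := fun x y => Subtype.ext (map_add ρ x y)
      map_smul' := fun c x => Subtype.ext (map_smul ρ c x)
      map_lie' := fun {x y} => Subtype.ext (map_lie ρ x y) }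
  -- Matrices commuting with `φ` are exactly the `A`-linear endomorphisms.
  let C : Subalgebra.centralizer K (Set.range φ) →ₐ[K] End A (Fin n → K) :=
    { toFun := fun X =>
        { T X.1 with
          map_smul' := by
            rintro ⟨a, ha⟩ v
            change T X.1 (a v) = a (T X.1 v)
            induction ha using Algebra.adjoin_induction generalizing v with
            | mem y hy =>
              obtain ⟨x, rfl⟩ := hy
              have := X.2 (φ x) ⟨x, rfl⟩
              rw [hρ, ← Module.End.mul_apply, ← map_mul, ← this, map_mul, Module.End.mul_apply]
            | algebraMap r => exact map_smul (T X.1) r v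
            | add a b _ _ ha hb => rw [LinearMap.add_apply, map_add, ha, hb, LinearMap.add_apply]
            | mul a b _ _ ha hb => rw [Module.End.mul_apply, ha, hb, Module.End.mul_apply] }
      map_one' := LinearMap.ext fun v => congrArg (fun f => f v) (map_one T)
      map_mul' := fun X Y => LinearMap.ext fun v => congrArg (fun f => f v) (map_mul T X.1 Y.1)
      map_zero' := LinearMap.ext fun v => congrArg (fun f => f v) (map_zero T)
      map_add' := fun X Y => LinearMap.ext fun v => congrArg (fun f => f v) (map_add T X.1 Y.1)
      commutes' := fun r => LinearMap.ext fun v => congrArg (fun f => f v) (T.commutes r) }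
  have hC : Function.Bijective C := by
    constructor
    · intro X Y h
      apply Subtype.ext
      apply T.injective
      exact LinearMap.ext fun w => congrArg (fun f => f w) h
    · intro f
      refine ⟨⟨T.symm (f.restrictScalars K), ?_⟩, ?_⟩
      · rintro _ ⟨x, rfl⟩
        apply T.injective
        rw [map_mul, map_mul, T.apply_symm_apply]
        exact LinearMap.ext fun w => (f.map_smul (ρA x) w).symm
      · ext1 v
        exact congrArg (fun g => g v) (T.apply_symm_apply (f.restrictScalars K))
  refine ⟨k, m, d, fun i => (τ i).toLieHom.comp ρA, hm, hd,
    hsum.trans (finrank_fin_fun K), fun x hx => ?_, ⟨(AlgEquiv.ofBijective C hC).trans E⟩⟩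
  apply T.injective
  rw [map_zero]
  exact LinearMap.ext fun v => hker (ρA x) hx v

end Centralizer

/-! ### Lower bounds for degrees of faithful representations. -/

section Simple

/-- A homomorphism from a simple Lie algebra is injective or zero. -/
theorem LieHom.injective_or_eq_zero_of_isSimple {K L L' : Type*} [CommRing K] [LieRing L]
    [LieAlgebra K L] [LieRing L'] [LieAlgebra K L'] [LieAlgebra.IsSimple K L] (f : L →ₗ⁅K⁆ L') :
    Function.Injective f ∨ ∀ x, f x = 0 := by
  rcases eq_bot_or_eq_top f.ker with h | h
  · exact Or.inl (f.ker_eq_bot.mp h)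
  · exact Or.inr fun x => f.mem_ker.mp (h ▸ LieSubmodule.mem_top x)

/-- `𝔤𝔩_0` and `𝔤𝔩_1` are abelian; a simple algebra is not. -/
theorem two_le_of_injective_of_isSimple {K L : Type*} [Field K] [LieRing L]
    [LieAlgebra K L] [LieAlgebra.IsSimple K L] {d : ℕ} (f : L →ₗ⁅K⁆ Matrix (Fin d) (Fin d) K)
    (hf : Function.Injective f) : 2 ≤ d := by
  by_contra h
  have hd : Subsingleton (Fin d) := Fin.subsingleton_iff_le_one.mpr (by omega)
  refine LieAlgebra.IsSimple.non_abelian K (L := L) ⟨fun x y => hf ?_⟩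
  rw [f.map_lie, map_zero, Ring.lie_def, sub_eq_zero]
  ext i j
  simp only [Matrix.mul_apply, Subsingleton.elim j i]
  exact Finset.sum_congr rfl fun k _ => by rw [Subsingleton.elim k i, mul_comm]

theorem minFaithfulDim_le {g : Type*} [LieRing g] [LieAlgebra ℂ g] {n : ℕ}
    (f : g →ₗ⁅ℂ⁆ Matrix (Fin n) (Fin n) ℂ) (hf : Function.Injective f) :
    minFaithfulDim g ≤ n :=
  Nat.sInf_le ⟨f, hf⟩

/-- For `m, d ≥ 2` this is `(m - 1)(d - 1) ≥ 1`. The case `m = 1` leaves no room for `t`. -/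
theorem add_le_mul_of_two_le {a t m d : ℕ} (ha : a ≤ d) (hd : 2 ≤ d) (hm : m ≠ 0) (ht : t ≤ m)
    (h1 : m = 1 → t = 0) : a + t ≤ m * d := by
  rcases eq_or_ne m 1 with rfl | hm1
  · rw [h1 rfl]; omega
  · obtain ⟨m, rfl⟩ : ∃ k, m = k + 2 := ⟨m - 2, by omega⟩
    obtain ⟨d, rfl⟩ : ∃ k, d = k + 2 := ⟨d - 2, by omega⟩
    nlinarith [Nat.zero_le (m * d)]

/-- Pairwise commuting faithful representations of simple Lie algebras on a common space require
at least the sum of their minimal degrees. -/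
theorem sum_minFaithfulDim_le_of_commute {ι : Type*} {L : ι → Type*} [∀ i, LieRing (L i)]
    [∀ i, LieAlgebra ℂ (L i)] [∀ i, FiniteDimensional ℂ (L i)] [∀ i, LieAlgebra.IsSimple ℂ (L i)]
    (T : Finset ι) : ∀ (n : ℕ) (ρ : ∀ i, L i →ₗ⁅ℂ⁆ Matrix (Fin n) (Fin n) ℂ),
      (∀ i ∈ T, Function.Injective (ρ i)) →
      (∀ i ∈ T, ∀ j ∈ T, i ≠ j → ∀ x y, ρ i x * ρ j y = ρ j y * ρ i x) →
      ∑ i ∈ T, minFaithfulDim (L i) ≤ n := by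
  classical
  induction T using Finset.strongInductionOn with
  | _ T ih =>
  intro n ρ hinj hcomm
  rcases T.eq_empty_or_nonempty with rfl | ⟨a, ha⟩
  · simp
  obtain ⟨T, haT, rfl⟩ : ∃ T', a ∉ T' ∧ T = insert a T' :=
    ⟨T.erase a, T.notMem_erase a, (Finset.insert_erase ha).symm⟩
  obtain ⟨k, m, d, τ, hm, hd, hn, hker, ⟨E⟩⟩ := (ρ a).exists_centralizer_algEquiv_pi_matrix
  have hcent : ∀ i, i ∈ T → ∀ x, ρ i x ∈ Subalgebra.centralizer ℂ (Set.range (ρ a)) := by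
    rintro i hi x _ ⟨y, rfl⟩
    exact hcomm a (Finset.mem_insert_self _ _) i (Finset.mem_insert_of_mem hi)
      (fun h => haT (h ▸ hi)) y x
  -- The other factors act on the multiplicity spaces of `ρ a`; outside `T` the zero map is a dummy
  -- value.
  have hf : ∀ i, ∃ f : ∀ j, L i →ₗ⁅ℂ⁆ Matrix (Fin (m j)) (Fin (m j)) ℂ,
      ∀ (hi : i ∈ T) x j, f j x = E ⟨ρ i x, hcent i hi x⟩ j := by
    intro i
    by_cases hi : i ∈ T
    · let c : L i →ₗ⁅ℂ⁆ Subalgebra.centralizer ℂ (Set.range (ρ a)) :=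
        { toFun := fun x => ⟨ρ i x, hcent i hi x⟩
          map_add' := fun x y => Subtype.ext (map_add (ρ i) x y)
          map_smul' := fun c x => Subtype.ext (map_smul (ρ i) c x)
          map_lie' := fun {x y} => Subtype.ext (LieHom.map_lie (ρ i) x y) }
      exact ⟨fun j => ((Pi.evalAlgHom ℂ (fun j => Matrix (Fin (m j)) (Fin (m j)) ℂ) j).comp
        E.toAlgHom).toLieHom.comp c, fun _ _ _ => rfl⟩
    · exact ⟨fun _ => 0, fun h => absurd h hi⟩
  choose f hf using hf
  let t : Fin k → ℕ := fun j =>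
    ∑ i ∈ T with Function.Injective (f i j), minFaithfulDim (L i)
  have ht : ∀ j, t j ≤ m j := by
    intro j
    refine ih _ ((Finset.filter_subset _ _).trans_ssubset (Finset.ssubset_insert haT)) _
      (fun i => f i j) (fun i hi => (Finset.mem_filter.mp hi).2) fun i hi i' hi' hne x y => ?_
    replace hi := (Finset.mem_filter.mp hi).1
    replace hi' := (Finset.mem_filter.mp hi').1
    rw [hf i hi, hf i' hi', ← Pi.mul_apply, ← Pi.mul_apply, ← map_mul, ← map_mul]
    refine congrArg (fun z => E z j) (Subtype.ext ?_)
    exact hcomm i (Finset.mem_insert_of_mem hi) i' (Finset.mem_insert_of_mem hi') hne x y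
  have ht1 : ∀ j, m j = 1 → t j = 0 := by
    intro j hj
    refine Finset.sum_eq_zero fun i hi => ?_
    have := two_le_of_injective_of_isSimple (f i j) (Finset.mem_filter.mp hi).2
    omega
  -- Each `L i` acts faithfully on some multiplicity space: otherwise, by simplicity, it acts by
  -- zero on all of them, hence `ρ i = 0`.
  have hT : ∑ i ∈ T, minFaithfulDim (L i) ≤ ∑ j, t j := by
    simp only [t, Finset.sum_filter]
    rw [Finset.sum_comm]
    refine Finset.sum_le_sum fun i hi => ?_
    obtain ⟨j, hj⟩ : ∃ j, Function.Injective (f i j) := by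
      by_contra! h
      have h0 : ∀ x, ρ i x = 0 := fun x => by
        have : E ⟨ρ i x, hcent i hi x⟩ = 0 := funext fun j => by
          rw [← hf i hi x j]
          exact ((f i j).injective_or_eq_zero_of_isSimple.resolve_left (h j)) x
        exact congrArg Subtype.val (E.injective (this.trans (map_zero E).symm))
      have := LieAlgebra.IsSimple.nontrivial (R := ℂ) (L := L i)
      obtain ⟨x, y, hxy⟩ := exists_pair_ne (L i)
      exact hxy (hinj i (Finset.mem_insert_of_mem hi) ((h0 x).trans (h0 y).symm))
    refine le_trans ?_ (Finset.single_le_sum (fun _ _ => Nat.zero_le _) (Finset.mem_univ j))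
    rw [if_pos hj]
  obtain ⟨j, hj⟩ : ∃ j, Function.Injective (τ j) := by
    by_contra! h
    have h0 : ∀ x, ρ a x = 0 := fun x => hker x fun j =>
      (τ j).injective_or_eq_zero_of_isSimple.resolve_left (h j) x
    have := LieAlgebra.IsSimple.nontrivial (R := ℂ) (L := L a)
    obtain ⟨x, y, hxy⟩ := exists_pair_ne (L a)
    exact hxy (hinj a (Finset.mem_insert_self _ _) ((h0 x).trans (h0 y).symm))
  -- One constituent `j` faithful for `L a` absorbs `μ(L a) + t j`; elsewhere `t i ≤ m i ≤ m i * d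
  -- i` suffices.
  rw [Finset.sum_insert haT, ← hn, ← Finset.add_sum_erase _ _ (Finset.mem_univ j)]
  rw [← Finset.add_sum_erase _ _ (Finset.mem_univ j)] at hT
  have h1 := add_le_mul_of_two_le (minFaithfulDim_le _ hj)
    (two_le_of_injective_of_isSimple _ hj) (hm j) (ht j) (ht1 j)
  have h2 : ∑ i ∈ Finset.univ.erase j, t i ≤ ∑ i ∈ Finset.univ.erase j, m i * d i :=
    Finset.sum_le_sum fun i _ =>
      (ht i).trans (Nat.le_mul_of_pos_right _ (Nat.pos_of_ne_zero (hd i)))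
  omega

end Simple

/-! ### Faithful representations of minimal degree. -/

section Irreducible

variable {s : Type*} [LieRing s] [LieAlgebra ℂ s] [FiniteDimensional ℂ s]
  [LieAlgebra.IsSimple ℂ s]
  {σ : s →ₗ⁅ℂ⁆ Matrix (Fin (minFaithfulDim s)) (Fin (minFaithfulDim s)) ℂ}

/-- Schur's lemma for a faithful representation of minimal degree of a simple Lie algebra. -/
theorem exists_eq_smul_one_of_commute_minimal (hσ : Function.Injective σ)
    {X : Matrix (Fin (minFaithfulDim s)) (Fin (minFaithfulDim s)) ℂ}
    (hX : ∀ x, X * σ x = σ x * X) : ∃ c : ℂ, X = c • 1 := by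
  obtain ⟨k, m, d, τ, hm, hd, hn, hker, ⟨E⟩⟩ := σ.exists_centralizer_algEquiv_pi_matrix
  obtain ⟨j, hj⟩ : ∃ j, Function.Injective (τ j) := by
    by_contra! h
    have h0 : ∀ x, σ x = 0 := fun x => hker x fun j =>
      (τ j).injective_or_eq_zero_of_isSimple.resolve_left (h j) x
    have := LieAlgebra.IsSimple.nontrivial (R := ℂ) (L := s)
    obtain ⟨x, y, hxy⟩ := exists_pair_ne s
    exact hxy (hσ ((h0 x).trans (h0 y).symm))
  -- The faithful constituent `τ j` already uses up the whole degree, so it is the only one and has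
  -- multiplicity one; the centralizer is then `𝔤𝔩_1`.
  have hle := minFaithfulDim_le _ hj
  have hpos : 0 < minFaithfulDim s := by have := two_le_of_injective_of_isSimple σ hσ; omega
  have hsum := Finset.add_sum_erase Finset.univ (fun i => m i * d i) (Finset.mem_univ j)
  simp only [hn] at hsum
  have hmd : d j ≤ m j * d j := Nat.le_mul_of_pos_left _ (Nat.pos_of_ne_zero (hm j))
  have hall : ∀ i, i = j := by
    intro i
    by_contra hij
    have h1 := Finset.single_le_sum (f := fun i => m i * d i) (fun _ _ => Nat.zero_le _)
      (Finset.mem_erase.mpr ⟨hij, Finset.mem_univ i⟩)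
    have h2 := Nat.mul_pos (Nat.pos_of_ne_zero (hm i)) (Nat.pos_of_ne_zero (hd i))
    omega
  have hmj : m j ≤ 1 := by
    by_contra h
    have := Nat.mul_le_mul_right (d j) (show 2 ≤ m j by omega)
    omega
  let X' : Subalgebra.centralizer ℂ (Set.range σ) :=
    ⟨X, by rintro _ ⟨x, rfl⟩; exact (hX x).symm⟩
  let z : Fin (m j) := ⟨0, Nat.pos_of_ne_zero (hm j)⟩
  have hEX : E X' = E X' j z z • 1 := by
    funext i
    obtain rfl := hall i
    ext a b
    have : Subsingleton (Fin (m i)) := Fin.subsingleton_iff_le_one.mpr hmj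
    rw [Subsingleton.elim a z, Subsingleton.elim b z]
    simp
  refine ⟨E X' j z z, ?_⟩
  have : X' = E X' j z z • 1 := E.injective (by rw [map_smul, map_one]; exact hEX)
  exact congrArg Subtype.val this

/-- The Casimir element of a faithful matrix representation of a simple Lie algebra. -/
theorem exists_casimir_matrix {n : ℕ} (φ : s →ₗ⁅ℂ⁆ Matrix (Fin n) (Fin n) ℂ)
    (hφ : Function.Injective φ) :
    ∃ M : Matrix (Fin n) (Fin n) ℂ, (∀ x, M * φ x = φ x * M) ∧ M ≠ 0 ∧
      (∀ {ι : Type} (R : Matrix (Fin n) ι ℂ), (∀ x, φ x * R = 0) → M * R = 0) ∧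
      (∀ {ι : Type} (Q : Matrix ι (Fin n) ℂ), (∀ x, Q * φ x = 0) → Q * M = 0) := by
  let T : Matrix (Fin n) (Fin n) ℂ ≃ₐ[ℂ] Module.End ℂ (Fin n → ℂ) := Matrix.toLinAlgEquiv'
  let ρ : s →ₗ⁅ℂ⁆ Module.End ℂ (Fin n → ℂ) := T.toAlgHom.toLieHom.comp φ
  let _ : LieRingModule s (Fin n → ℂ) := LieRingModule.compLieHom _ ρ
  have _ : LieModule ℂ s (Fin n → ℂ) := LieModule.compLieHom _ ρ
  have hρ : ∀ (x : s) (v : Fin n → ℂ), ⁅x, v⁆ = (φ x).mulVec v := fun x v => rfl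
  have hT : ∀ x, LieModule.toEnd ℂ s (Fin n → ℂ) x = T (φ x) := fun x => rfl
  obtain ⟨Ω, hcomm, hW, hinv, htr⟩ := LieModule.exists_casimir ℂ s (Fin n → ℂ)
  have hΩ : ∀ v, (T.symm Ω).mulVec v = Ω v := fun v =>
    congrArg (fun f => f v) (T.apply_symm_apply Ω)
  refine ⟨T.symm Ω, fun x => ?_, ?_, fun R hR => ?_, fun Q hQ => ?_⟩
  · apply T.injective
    rw [map_mul, map_mul, T.apply_symm_apply]
    exact hcomm x
  · intro h0
    rw [map_eq_zero_iff _ T.symm.injective] at h0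
    rw [h0, map_zero, eq_comm, Nat.cast_eq_zero, Submodule.finrank_eq_zero,
      LinearMap.range_eq_bot] at htr
    have := LieAlgebra.IsSimple.nontrivial (R := ℂ) (L := s)
    obtain ⟨x, y, hxy⟩ := exists_pair_ne s
    have hz : ∀ x, φ x = 0 := fun x => T.injective <| by
      rw [← hT, map_zero]
      exact congrArg (fun f => f x) htr
    exact hxy (hφ ((hz x).trans (hz y).symm))
  · ext i j
    have := hinv (fun k => R k j) fun x => by
      rw [hρ]
      funext k
      exact congrFun (congrFun (hR x) k) j
    rw [← hΩ] at this
    exact congrFun this i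
  -- The kernel of `Q` contains `𝔰V`, hence the range of the Casimir operator.
  · have h := hW (LinearMap.ker Q.mulVecLin) fun x v => by
      rw [hρ, LinearMap.mem_ker, Matrix.mulVecLin_apply, Matrix.mulVec_mulVec, hQ,
        Matrix.zero_mulVec]
    ext i j
    have := h (Pi.single j 1)
    rw [← hΩ, LinearMap.mem_ker, Matrix.mulVecLin_apply, Matrix.mulVec_mulVec,
      Matrix.mulVec_single_one] at this
    exact congrFun this i

/-- In a faithful representation of minimal degree, the Casimir element is a nonzero scalar. -/
theorem exists_ne_zero_casimir_minimal (hσ : Function.Injective σ) :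
    ∃ c : ℂ, c ≠ 0 ∧
      (∀ {ι : Type} (R : Matrix (Fin (minFaithfulDim s)) ι ℂ), (∀ x, σ x * R = 0) → c • R = 0) ∧
      (∀ {ι : Type} (Q : Matrix ι (Fin (minFaithfulDim s)) ℂ), (∀ x, Q * σ x = 0) → c • Q = 0) := by
  obtain ⟨M, hM, hM0, hR, hQ⟩ := exists_casimir_matrix σ hσ
  obtain ⟨c, rfl⟩ := exists_eq_smul_one_of_commute_minimal hσ hM
  refine ⟨c, fun h => hM0 (by rw [h, zero_smul]), fun R h => ?_, fun Q h => ?_⟩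
  · simpa using hR R h
  · simpa using hQ Q h

/-- The columns of `R` are invariant vectors; the Casimir operator kills them, yet acts by a nonzero
scalar. -/
theorem eq_zero_of_minimal_mul_eq_zero (hσ : Function.Injective σ) {ι : Type}
    {R : Matrix (Fin (minFaithfulDim s)) ι ℂ} (h : ∀ x, σ x * R = 0) : R = 0 := by
  obtain ⟨c, hc, hR, -⟩ := exists_ne_zero_casimir_minimal hσ
  exact (smul_eq_zero.mp (hR R h)).resolve_left hc

theorem eq_zero_of_mul_minimal_eq_zero (hσ : Function.Injective σ) {ι : Type}
    {Q : Matrix ι (Fin (minFaithfulDim s)) ℂ} (h : ∀ x, Q * σ x = 0) : Q = 0 := by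
  obtain ⟨c, hc, -, hQ⟩ := exists_ne_zero_casimir_minimal hσ
  exact (smul_eq_zero.mp (hQ Q h)).resolve_left hc

end Irreducible

/-! ### Block matrices and direct sums of representations. -/

section Block

theorem Matrix.submatrix_mul_blockDiagonal' {ι : Type*} {κ : Type*} [Fintype κ] [DecidableEq κ]
    {d : κ → ℕ} (X : Matrix ι (Σ i, Fin (d i)) ℂ) (B : ∀ i, Matrix (Fin (d i)) (Fin (d i)) ℂ)
    (j : κ) :
    (X * Matrix.blockDiagonal' B).submatrix id (Sigma.mk j) =
      X.submatrix id (Sigma.mk j) * B j := by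
  ext p b
  rw [Matrix.submatrix_apply, Matrix.mul_apply, Fintype.sum_sigma, Finset.sum_eq_single j]
  · simp [Matrix.mul_apply, Matrix.blockDiagonal'_apply_eq]
  · intro i _ hij
    refine Finset.sum_eq_zero fun a _ => ?_
    rw [Matrix.blockDiagonal'_apply_ne _ _ _ hij, mul_zero]
  · simp

theorem Matrix.submatrix_blockDiagonal'_mul {ι : Type*} {κ : Type*} [Fintype κ] [DecidableEq κ]
    {d : κ → ℕ} (X : Matrix (Σ i, Fin (d i)) ι ℂ) (B : ∀ i, Matrix (Fin (d i)) (Fin (d i)) ℂ)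
    (j : κ) :
    (Matrix.blockDiagonal' B * X).submatrix (Sigma.mk j) id =
      B j * X.submatrix (Sigma.mk j) id := by
  ext b p
  rw [Matrix.submatrix_apply, Matrix.mul_apply, Fintype.sum_sigma, Finset.sum_eq_single j]
  · simp [Matrix.mul_apply, Matrix.blockDiagonal'_apply_eq]
  · intro i _ hij
    refine Finset.sum_eq_zero fun a _ => ?_
    rw [Matrix.blockDiagonal'_apply_ne _ _ _ hij.symm, zero_mul]
  · simp

/-- Matrix representations of total degree at most `N` have a direct sum, padded by a trivial
representation, of degree `N`. -/
theorem exists_lieHom_matrix_of_sum_le {L κ : Type*} [LieRing L] [LieAlgebra ℂ L] [Fintype κ]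
    [DecidableEq κ] (d : κ → ℕ) (f : ∀ k, L →ₗ⁅ℂ⁆ Matrix (Fin (d k)) (Fin (d k)) ℂ) {N : ℕ}
    (hN : ∑ k, d k ≤ N) :
    ∃ F : L →ₗ⁅ℂ⁆ Matrix (Fin N) (Fin N) ℂ, ∀ x, F x = 0 → ∀ k, f k x = 0 := by
  let F₀ : L →ₗ⁅ℂ⁆ Matrix (Fin (N - ∑ k, d k) ⊕ Σ k, Fin (d k))
      (Fin (N - ∑ k, d k) ⊕ Σ k, Fin (d k)) ℂ :=
    { toFun := fun x => Matrix.fromBlocks 0 0 0 (Matrix.blockDiagonal' fun k => f k x)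
      map_add' := fun x y => by
        simp only [map_add, Matrix.fromBlocks_add, add_zero]
        rw [← Matrix.blockDiagonal'_add]
        rfl
      map_smul' := fun c x => by
        simp only [map_smul, Matrix.fromBlocks_smul, smul_zero, RingHom.id_apply]
        rw [← Matrix.blockDiagonal'_smul]
        rfl
      map_lie' := fun {x y} => by
        simp only [LieHom.map_lie, Ring.lie_def, Matrix.fromBlocks_multiply, Matrix.mul_zero,
          Matrix.zero_mul, add_zero, zero_add, sub_eq_add_neg, Matrix.fromBlocks_neg,
          Matrix.fromBlocks_add, neg_zero]
        rw [← Matrix.blockDiagonal'_mul, ← Matrix.blockDiagonal'_mul, ← Matrix.blockDiagonal'_neg,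
          ← Matrix.blockDiagonal'_add]
        rfl }
  have hcard : Fintype.card (Fin (N - ∑ k, d k) ⊕ Σ k, Fin (d k)) = Fintype.card (Fin N) := by
    simp [hN]
  let e := Matrix.reindexLieEquiv (R := ℂ) (Fintype.equivOfCardEq hcard)
  refine ⟨e.toLieHom.comp F₀, fun x hx k => ?_⟩
  have h0 : F₀ x = 0 := e.injective (hx.trans e.toLieHom.map_zero.symm)
  have h1 : Matrix.blockDiagonal' (fun k => f k x) = 0 := congrArg Matrix.toBlocks₂₂ h0
  have h2 : (fun k => f k x) = 0 :=
    Matrix.blockDiagonal'_injective (h1.trans Matrix.blockDiagonal'_zero.symm)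
  exact congrFun h2 k

end Block

/-! ### Sums of simple ideals and their centralizers. -/

section Decomposition

variable {g : Type*} [LieRing g] [LieAlgebra ℂ g] {l : ℕ} {s : Fin l → LieIdeal ℂ g}

theorem sumEquiv_of (hs : DirectSum.IsInternal s) (i : Fin l) (y : s i) :
    sumEquiv hs (DirectSum.of (fun i => s i) i y) = y :=
  DirectSum.toModule_lof (M := fun i => s i)
    (φ := fun i => ((s i).incl : s i →ₗ[ℂ] g)) ℂ i y

theorem idealProj_apply (hs : DirectSum.IsInternal s) (i : Fin l) (x : g) :
    idealProj hs i x = (sumEquiv hs).symm x i := rfl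

theorem idealProj_self (hs : DirectSum.IsInternal s) (i : Fin l) (y : s i) :
    idealProj hs i (y : g) = y := by
  rw [idealProj_apply, ← sumEquiv_of hs, LieEquiv.symm_apply_apply, DirectSum.of_eq_same]

theorem idealProj_of_ne (hs : DirectSum.IsInternal s) {i j : Fin l} (hij : j ≠ i) (y : s i) :
    idealProj hs j (y : g) = 0 := by
  rw [idealProj_apply, ← sumEquiv_of hs, LieEquiv.symm_apply_apply,
    DirectSum.of_eq_of_ne _ _ _ hij]

theorem eq_zero_of_idealProj_eq_zero (hs : DirectSum.IsInternal s) {x : g}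
    (h : ∀ i, idealProj hs i x = 0) : x = 0 := by
  have : (sumEquiv hs).symm x = 0 := DFinsupp.ext h
  rw [← (sumEquiv hs).apply_symm_apply x, this]
  exact (sumEquiv hs).toLieHom.map_zero

/-- A direct sum of simple ideals is semisimple. -/
theorem hasTrivialRadical_of_isInternal [FiniteDimensional ℂ g]
    (hsimple : ∀ i, LieAlgebra.IsSimple ℂ (s i)) (hs : DirectSum.IsInternal s) :
    LieAlgebra.HasTrivialRadical ℂ g := by
  rw [LieAlgebra.hasTrivialRadical_iff_no_abelian_ideals]
  intro A hA
  rw [eq_bot_iff]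
  intro x hx
  refine (LieSubmodule.mem_bot x).mpr (eq_zero_of_idealProj_eq_zero hs fun i => ?_)
  have hsurj : Function.Surjective (idealProj hs i) := fun y => ⟨y, idealProj_self hs i y⟩
  -- An abelian ideal projects onto an abelian ideal of each `s i`, which must vanish.
  have h1 : ⁅A.map (idealProj hs i), A.map (idealProj hs i)⁆ = ⊥ := by
    rw [← LieIdeal.map_bracket_eq _ hsurj, (LieSubmodule.lie_abelian_iff_lie_self_eq_bot A).mp hA]
    exact LieIdeal.map_eq_bot_iff.mpr bot_le
  have h2 := (LieAlgebra.hasTrivialRadical_iff_no_abelian_ideals ℂ (s i)).mp inferInstance _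
    ((LieSubmodule.lie_abelian_iff_lie_self_eq_bot _).mpr h1)
  exact (LieSubmodule.mem_bot _).mp (h2 ▸ LieIdeal.mem_map hx)

/-- A representation which is nontrivial on each simple ideal has degree at least the sum of the
minimal degrees of the simple ideals. -/
theorem sum_minFaithfulDim_le_of_isInternal [FiniteDimensional ℂ g]
    (hsimple : ∀ i, LieAlgebra.IsSimple ℂ (s i)) (hs : DirectSum.IsInternal s) {n : ℕ}
    (φ : g →ₗ⁅ℂ⁆ Matrix (Fin n) (Fin n) ℂ)
    (hφ : ∀ i, ∃ x : s i, φ x ≠ 0) : ∑ i, minFaithfulDim (s i) ≤ n := by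
  have : ∀ i, FiniteDimensional ℂ (s i) := fun i =>
    inferInstanceAs (FiniteDimensional ℂ (s i).toSubmodule)
  refine sum_minFaithfulDim_le_of_commute (L := fun i => s i) Finset.univ n
    (fun i => φ.comp (s i).incl) (fun i _ => ?_) fun i _ j _ hij x y => ?_
  · obtain ⟨x, hx⟩ := hφ i
    exact (φ.comp (s i).incl).injective_or_eq_zero_of_isSimple.resolve_right fun h => hx (h x)
  · rw [← sub_eq_zero, ← Ring.lie_def]
    have := congrArg φ (lie_eq_zero_of_isInternal hs hij x y)
    rwa [LieHom.map_lie, map_zero] at this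

/-- `μ` is additive on direct sums of simple Lie algebras. -/
theorem sum_minFaithfulDim_eq [FiniteDimensional ℂ g]
    (hsimple : ∀ i, LieAlgebra.IsSimple ℂ (s i)) (hs : DirectSum.IsInternal s)
    (σ : ∀ i, s i →ₗ⁅ℂ⁆ Matrix (Fin (minFaithfulDim (s i))) (Fin (minFaithfulDim (s i))) ℂ)
    (hσ : ∀ i, Function.Injective (σ i)) :
    ∑ i, minFaithfulDim (s i) = minFaithfulDim g := by
  obtain ⟨F, hF⟩ := exists_lieHom_matrix_of_sum_le (fun i => minFaithfulDim (s i))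
    (fun i => (σ i).comp (idealProj hs i)) le_rfl
  have hFinj : Function.Injective F := by
    refine (injective_iff_map_eq_zero F).mpr fun x hx =>
      eq_zero_of_idealProj_eq_zero hs fun i => hσ i ?_
    rw [map_zero]
    exact hF x hx i
  refine le_antisymm ?_ (minFaithfulDim_le F hFinj)
  obtain ⟨φ, hφ⟩ : ∃ φ : g →ₗ⁅ℂ⁆ Matrix (Fin (minFaithfulDim g)) (Fin (minFaithfulDim g)) ℂ,
      Function.Injective φ :=
    Nat.sInf_mem (s := {n : ℕ | ∃ φ : g →ₗ⁅ℂ⁆ Matrix (Fin n) (Fin n) ℂ, Function.Injective φ})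
      ⟨_, F, hFinj⟩
  refine sum_minFaithfulDim_le_of_isInternal hsimple hs φ fun i => ?_
  have := LieAlgebra.IsSimple.nontrivial (R := ℂ) (L := s i)
  obtain ⟨x, hx⟩ := exists_ne (0 : s i)
  exact ⟨x, fun h => hx (Subtype.ext (hφ (h.trans φ.map_zero.symm)))⟩

/-- Embedding of the centralizer of a faithful representation. -/
theorem exists_injective_repCentralizer [FiniteDimensional ℂ g]
    (hsimple : ∀ i, LieAlgebra.IsSimple ℂ (s i)) (hs : DirectSum.IsInternal s) {n : ℕ}
    (φ : g →ₗ⁅ℂ⁆ Matrix (Fin n) (Fin n) ℂ) (hφ : Function.Injective φ) :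
    ∃ f : repCentralizer φ →ₗ⁅ℂ⁆ Matrix (Fin (n - ∑ i, minFaithfulDim (s i)))
        (Fin (n - ∑ i, minFaithfulDim (s i))) ℂ × (Fin l → ℂ), Function.Injective f := by
  classical
  have := hasTrivialRadical_of_isInternal hsimple hs
  obtain ⟨k, m, d, τ, hm, hd, hn, hker, ⟨E⟩⟩ := φ.exists_centralizer_algEquiv_pi_matrix
  have hj : ∀ i, ∃ j, ∃ x : s i, τ j x ≠ 0 := by
    intro i
    by_contra! h
    have := LieAlgebra.IsSimple.nontrivial (R := ℂ) (L := s i)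
    obtain ⟨x, hx⟩ := exists_ne (0 : s i)
    exact hx (Subtype.ext (hφ ((hker x fun j => h j x).trans φ.map_zero.symm)))
  choose j x hx using hj
  let J : Finset (Fin k) := Finset.univ.image j
  have hd2 : ∀ a ∈ J, 2 ≤ d a := by
    intro a ha
    obtain ⟨i, -, rfl⟩ := Finset.mem_image.mp ha
    exact two_le_of_injective_of_isSimple ((τ (j i)).comp (s i).incl)
      (LieHom.injective_or_eq_zero_of_isSimple _ |>.resolve_right fun h => hx i (h (x i)))
  -- The sum of the `τ a`, `a ∈ J`, each taken once, is already nontrivial on every `s i`.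
  have hJ : ∑ i, minFaithfulDim (s i) ≤ ∑ a ∈ J, d a := by
    obtain ⟨F, hF⟩ := exists_lieHom_matrix_of_sum_le (fun a : J => d a) (fun a => τ a) le_rfl
    rw [← Finset.sum_coe_sort J]
    exact sum_minFaithfulDim_le_of_isInternal hsimple hs F fun i =>
      ⟨x i, fun h => hx i (hF _ h ⟨j i, Finset.mem_image_of_mem j (Finset.mem_univ i)⟩)⟩
  -- The blocks left out of `B` have centralizer factor `ℂ` and go into `ℂ^l`.
  let B : Finset (Fin k) := Finset.univ.filter fun a => ¬ (a ∈ J ∧ m a = 1)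
  have hB : ∑ a : B, m a ≤ n - ∑ i, minFaithfulDim (s i) := by
    rw [Finset.sum_coe_sort B m]
    have h1 : ∑ a ∈ B, m a + ∑ a ∈ J, d a ≤ n := by
      have hJs : ∑ a ∈ J, d a = ∑ a, if a ∈ J then d a else 0 := by simp
      rw [← hn, Finset.sum_filter, hJs, ← Finset.sum_add_distrib]
      refine Finset.sum_le_sum fun a _ => ?_
      have hda := hd a
      have hma := hm a
      by_cases haJ : a ∈ J
      · have h2 := hd2 a haJ
        rw [if_pos haJ]
        by_cases h1 : m a = 1
        · rw [if_neg (fun h => h ⟨haJ, h1⟩), h1, zero_add, one_mul]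
        · rw [if_pos (fun h => h1 h.2), add_comm]
          exact add_le_mul_of_two_le le_rfl h2 hma le_rfl fun h => absurd h h1
      · rw [if_neg haJ, if_pos (fun h => haJ h.1), add_zero]
        exact Nat.le_mul_of_pos_right _ (Nat.pos_of_ne_zero hda)
    omega
  obtain ⟨G, hG⟩ := exists_lieHom_matrix_of_sum_le (fun a : B => m a)
    (fun a => (Pi.evalAlgHom ℂ (fun a => Matrix (Fin (m a)) (Fin (m a)) ℂ) a).toLieHom) hB
  let c : repCentralizer φ →ₗ⁅ℂ⁆ (∀ a, Matrix (Fin (m a)) (Fin (m a)) ℂ) :=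
    E.toAlgHom.toLieHom.comp
      { toFun := fun A => ⟨A.1, by
          rintro _ ⟨y, rfl⟩
          exact (sub_eq_zero.mp (A.2 y)).symm⟩
        map_add' := fun _ _ => rfl
        map_smul' := fun _ _ => rfl
        map_lie' := rfl }
  have hc : ∀ A, c A = 0 → A = 0 := fun A hA => by
    have := congrArg Subtype.val (E.injective (hA.trans (map_zero E).symm))
    exact Subtype.ext this
  refine ⟨
    -- On a `1 × 1` block the trace is the entry itself. On larger blocks it is redundant, but it
    -- kills brackets, so the map is a homomorphism into the abelian factor.
    { toFun := fun A => (G (c A), fun i => Matrix.trace (c A (j i)))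
      map_add' := fun A A' => ?_
      map_smul' := fun r A => ?_
      map_lie' := fun {A A'} => ?_ }, ?_⟩
  · ext <;> simp
  · ext <;> simp
  · refine Prod.ext (by simp) ?_
    funext i
    have h1 : c ⁅A, A'⁆ (j i) = ⁅c A (j i), c A' (j i)⁆ := by rw [LieHom.map_lie]; rfl
    change Matrix.trace (c ⁅A, A'⁆ (j i)) = ⁅Matrix.trace (c A (j i)), Matrix.trace (c A' (j i))⁆
    rw [h1, Ring.lie_def, Ring.lie_def, Matrix.trace_sub, Matrix.trace_mul_comm, sub_self, mul_comm,
      sub_self]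
  · refine (injective_iff_map_eq_zero (LieHom.toLinearMap _)).mpr fun A hA => hc A ?_
    have hA1 : G (c A) = 0 := congrArg Prod.fst hA
    have hA2 : ∀ i, Matrix.trace (c A (j i)) = 0 := fun i => congrFun (congrArg Prod.snd hA) i
    funext a
    by_cases ha : a ∈ J ∧ m a = 1
    · obtain ⟨haJ, hma⟩ := ha
      obtain ⟨i, -, rfl⟩ := Finset.mem_image.mp haJ
      have : Subsingleton (Fin (m (j i))) := Fin.subsingleton_iff_le_one.mpr hma.le
      ext p q
      have h := hA2 i
      rw [Matrix.trace, Fintype.sum_eq_single p fun q hq => absurd (Subsingleton.elim q p) hq,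
        Matrix.diag_apply] at h
      rw [Subsingleton.elim q p, h]
      rfl
    · exact hG _ hA1 ⟨a, Finset.mem_filter.mpr ⟨Finset.mem_univ a, ha⟩⟩

/-- The centralizer of the standard block representation. -/
theorem nonempty_repCentralizer_blockRep_lieEquiv [FiniteDimensional ℂ g]
    (hsimple : ∀ i, LieAlgebra.IsSimple ℂ (s i)) (hs : DirectSum.IsInternal s)
    (σ : ∀ i, s i →ₗ⁅ℂ⁆ Matrix (Fin (minFaithfulDim (s i))) (Fin (minFaithfulDim (s i))) ℂ)
    (hσ : ∀ i, Function.Injective (σ i)) (m : ℕ) :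
    Nonempty (repCentralizer (blockRep hs m (fun i => minFaithfulDim (s i)) σ) ≃ₗ⁅ℂ⁆
      Matrix (Fin m) (Fin m) ℂ × (Fin l → ℂ)) := by
  have : ∀ i, FiniteDimensional ℂ (s i) := fun i =>
    inferInstanceAs (FiniteDimensional ℂ (s i).toSubmodule)
  have happ : ∀ x, blockRep hs m (fun i => minFaithfulDim (s i)) σ x =
    Matrix.fromBlocks 0 0 0 (Matrix.blockDiagonal' fun i => σ i (idealProj hs i x)) := fun x => rfl
  let D : (Fin l → ℂ) → Matrix (Σ i, Fin (minFaithfulDim (s i)))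
      (Σ i, Fin (minFaithfulDim (s i))) ℂ := fun c => Matrix.blockDiagonal' fun i => c i • 1
  have hDD : ∀ c c', D c * D c' = D (c * c') := fun c c' => by
    simp only [D]
    rw [← Matrix.blockDiagonal'_mul]
    simp [smul_smul, mul_comm]
  let F : Matrix (Fin m) (Fin m) ℂ × (Fin l → ℂ) →ₗ⁅ℂ⁆
      repCentralizer (blockRep hs m (fun i => minFaithfulDim (s i)) σ) :=
    { toFun := fun P => ⟨Matrix.fromBlocks P.1 0 0 (D P.2), fun x => by
        rw [happ, Ring.lie_def, Matrix.fromBlocks_multiply, Matrix.fromBlocks_multiply]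
        simp only [D]
        rw [← Matrix.blockDiagonal'_mul, ← Matrix.blockDiagonal'_mul]
        simp⟩
      map_add' := fun P Q => Subtype.ext <| by
        change _ = Matrix.fromBlocks P.1 0 0 (D P.2) + Matrix.fromBlocks Q.1 0 0 (D Q.2)
        have : D (P.2 + Q.2) = D P.2 + D Q.2 := by
          simp only [D]
          rw [← Matrix.blockDiagonal'_add]
          simp only [Pi.add_apply, add_smul]
          rfl
        simp [Matrix.fromBlocks_add, this]
      map_smul' := fun r P => Subtype.ext <| by
        change _ = r • Matrix.fromBlocks P.1 0 0 (D P.2)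
        have : D (r • P.2) = r • D P.2 := by
          simp only [D]
          rw [← Matrix.blockDiagonal'_smul]
          simp only [Pi.smul_apply, smul_assoc]
          rfl
        simp [Matrix.fromBlocks_smul, this]
      map_lie' := fun {P Q} => Subtype.ext <| by
        change Matrix.fromBlocks ⁅P, Q⁆.1 0 0 (D ⁅P, Q⁆.2) =
          ⁅Matrix.fromBlocks P.1 0 0 (D P.2), Matrix.fromBlocks Q.1 0 0 (D Q.2)⁆
        have h0 : ⁅P, Q⁆.2 = 0 := by
          change ⁅P.2, Q.2⁆ = 0
          funext i
          change ⁅P.2 i, Q.2 i⁆ = 0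
          rw [Ring.lie_def, mul_comm, sub_self]
        have h1 : D 0 = 0 := by
          simp only [D, Pi.zero_apply, zero_smul]
          exact Matrix.blockDiagonal'_zero
        have h2 : ⁅P, Q⁆.1 = ⁅P.1, Q.1⁆ := rfl
        rw [h0, h1, h2, Ring.lie_def, Ring.lie_def, Matrix.fromBlocks_multiply,
          Matrix.fromBlocks_multiply, hDD, hDD, mul_comm Q.2]
        simp only [sub_eq_add_neg, Matrix.fromBlocks_neg, Matrix.fromBlocks_add]
        simp }
  have hF : Function.Bijective F := by
    constructor
    · refine (injective_iff_map_eq_zero F.toLinearMap).mpr fun P hP => ?_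
      have hP' : Matrix.fromBlocks P.1 0 0 (D P.2) = 0 := congrArg Subtype.val hP
      refine Prod.ext (congrArg Matrix.toBlocks₁₁ hP') ?_
      funext i
      -- The block is nonempty, so its scalar can be read off a diagonal entry.
      have hpos := two_le_of_injective_of_isSimple (σ i) (hσ i)
      have := congrFun (congrFun (congrArg Matrix.toBlocks₂₂ hP') ⟨i, ⟨0, by omega⟩⟩)
        ⟨i, ⟨0, by omega⟩⟩
      simpa [D, Matrix.toBlocks₂₂, Matrix.blockDiagonal'_apply_eq] using this
    · rintro ⟨A, hA⟩
      have hcomm : ∀ x, A.toBlocks₁₂ * (Matrix.blockDiagonal' fun i => σ i (idealProj hs i x)) = 0 ∧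
          (Matrix.blockDiagonal' fun i => σ i (idealProj hs i x)) * A.toBlocks₂₁ = 0 ∧
          A.toBlocks₂₂ * (Matrix.blockDiagonal' fun i => σ i (idealProj hs i x)) =
          (Matrix.blockDiagonal' fun i => σ i (idealProj hs i x)) * A.toBlocks₂₂ := by
        intro x
        have h := sub_eq_zero.mp (hA x)
        rw [happ, ← Matrix.fromBlocks_toBlocks A, Matrix.fromBlocks_multiply,
          Matrix.fromBlocks_multiply, Matrix.fromBlocks_inj] at h
        simpa [eq_comm] using h
      have h12 : A.toBlocks₁₂ = 0 := by
        have : ∀ i, A.toBlocks₁₂.submatrix id (Sigma.mk i) = 0 := fun i =>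
          eq_zero_of_mul_minimal_eq_zero (hσ i) fun x => by
            have := congrArg (fun X => X.submatrix id (Sigma.mk i)) (hcomm (x : g)).1
            simpa only [Matrix.submatrix_mul_blockDiagonal', idealProj_self, Matrix.submatrix_zero, Pi.zero_apply] using this
        ext p ⟨i, a⟩
        exact congrFun (congrFun (this i) p) a
      have h21 : A.toBlocks₂₁ = 0 := by
        have : ∀ i, A.toBlocks₂₁.submatrix (Sigma.mk i) id = 0 := fun i =>
          eq_zero_of_minimal_mul_eq_zero (hσ i) fun x => by
            have := congrArg (fun X => X.submatrix (Sigma.mk i) id) (hcomm (x : g)).2.1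
            simpa only [Matrix.submatrix_blockDiagonal'_mul, idealProj_self, Matrix.submatrix_zero, Pi.zero_apply] using this
        ext ⟨i, a⟩ p
        exact congrFun (congrFun (this i) a) p
      have h22 : ∀ x i j, A.toBlocks₂₂.submatrix (Sigma.mk i) (Sigma.mk j) *
          σ j (idealProj hs j x) = σ i (idealProj hs i x) *
          A.toBlocks₂₂.submatrix (Sigma.mk i) (Sigma.mk j) := by
        intro x i j
        have h := congrArg (fun X => (X.submatrix id (Sigma.mk j)).submatrix (Sigma.mk i) id)
          (hcomm x).2.2
        have h' := Matrix.submatrix_blockDiagonal'_mul (A.toBlocks₂₂.submatrix id (Sigma.mk j))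
          (fun i => σ i (idealProj hs i x)) i
        simp only [Matrix.submatrix_mul_blockDiagonal'] at h
        exact h.trans h'
      -- For `x` in `s i`, block `j` acts by zero while block `i` acts by `σ i`, which has no
      -- nonzero invariants.
      have hne : ∀ i j, i ≠ j → A.toBlocks₂₂.submatrix (Sigma.mk i) (Sigma.mk j) = 0 :=
        fun i j hij => eq_zero_of_minimal_mul_eq_zero (hσ i) fun x => by
          have := h22 (x : g) i j
          rw [idealProj_self, idealProj_of_ne hs hij.symm, map_zero, Matrix.mul_zero] at this
          exact this.symm
      have hself : ∀ i, ∃ c : ℂ, A.toBlocks₂₂.submatrix (Sigma.mk i) (Sigma.mk i) = c • 1 :=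
        fun i => exists_eq_smul_one_of_commute_minimal (hσ i) fun x => by
          have := h22 (x : g) i i
          rwa [idealProj_self] at this
      choose c hc using hself
      refine ⟨(A.toBlocks₁₁, c), Subtype.ext ?_⟩
      change Matrix.fromBlocks A.toBlocks₁₁ 0 0 (D c) = A
      have hD : D c = A.toBlocks₂₂ := by
        ext ⟨i, a⟩ ⟨j, b⟩
        by_cases hij : i = j
        · subst hij
          simp only [D, Matrix.blockDiagonal'_apply_eq]
          rw [← hc]
          rfl
        · simp only [D]
          rw [Matrix.blockDiagonal'_apply_ne _ _ _ hij]
          exact (congrFun (congrFun (hne i j hij) a) b).symm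
      conv_rhs => rw [← Matrix.fromBlocks_toBlocks A, h12, h21, ← hD]
  exact ⟨(LieEquiv.ofBijective F hF).symm⟩

end Decomposition

theorem proposition2p15
    {g : Type*} [LieRing g] [LieAlgebra ℂ g] [FiniteDimensional ℂ g]
    -- `𝔤 = 𝔰_1 ⊕ ⋯ ⊕ 𝔰_l` is semisimple of length `l`
    (l : ℕ) (s : Fin l → LieIdeal ℂ g)
    (hsimple : ∀ i, LieAlgebra.IsSimple ℂ (s i))
    (hsum : DirectSum.IsInternal s)
    -- faithful representations of minimal dimension of the simple summands
    (σ : ∀ i, s i →ₗ⁅ℂ⁆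
      Matrix (Fin (minFaithfulDim (s i))) (Fin (minFaithfulDim (s i))) ℂ)
    (hσ : ∀ i, Function.Injective (σ i))
    (n : ℕ) (hn : minFaithfulDim g ≤ n) :
    -- the standard block representation has degree `n`
    (n - minFaithfulDim g) + ∑ i, minFaithfulDim (s i) = n ∧
    (∀ φ : g →ₗ⁅ℂ⁆ Matrix (Fin n) (Fin n) ℂ, Function.Injective φ →
      ∃ f : repCentralizer φ →ₗ⁅ℂ⁆
          repCentralizer (blockRep hsum (n - minFaithfulDim g) (fun i => minFaithfulDim (s i)) σ),
        Function.Injective f) ∧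
    Nonempty
      (repCentralizer (blockRep hsum (n - minFaithfulDim g) (fun i => minFaithfulDim (s i)) σ)
        ≃ₗ⁅ℂ⁆ Matrix (Fin (n - minFaithfulDim g)) (Fin (n - minFaithfulDim g)) ℂ × (Fin l → ℂ)) := by
  rw [← sum_minFaithfulDim_eq hsimple hsum σ hσ] at hn ⊢
  obtain ⟨e⟩ := nonempty_repCentralizer_blockRep_lieEquiv hsimple hsum σ hσ
    (n - ∑ i, minFaithfulDim (s i))
  refine ⟨Nat.sub_add_cancel hn, fun φ hφ => ?_, ⟨e⟩⟩
  obtain ⟨f, hf⟩ := exists_injective_repCentralizer hsimple hsum φ hφ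
  exact ⟨e.symm.toLieHom.comp f, e.symm.injective.comp hf⟩
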